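/- Let $p_0\ge p_1\ge p_2\ge\cdots\ge 0$ be real numbers with $p_n\to 0$, and let $B=\bigcup_{n\ge 0}[n,n+1]\times[0,p_n]$ be the associated infinite step billiard table. Assume that $B$ has at least one corner of interior angle $3\pi/2$, i.e. that $0<p_{k}<p_{k-1}$ for some $k\ge 1$ (this is automatic if all $p_n$ are positive; it excludes only finite rectangles and the degenerate table with all $p_n = 0$). Let $S$ be the surface obtained from the four copies $\{(X,Y)\in\mathbb R^2 : (|X|,|Y|)\in B\}$ of $B$ by identifying $(X,Y)$ with $(-X,Y)$ when $(|X|,|Y|)$ lies on a vertical side $\{k\}\times[p_k,p_{k-1}]$ with $k\ge1$, $p_k<p_{k-1}$, and $(X,Y)$ with $(X,-Y)$ when $(|X|,|Y|)$ lies on a horizontal side $[n,n+1]\times\{p_n\}$. For $\vartheta\in{]0,\pi/2[}$ the billiard flow in direction $\vartheta$ is the unit-speed straight-line motion on $S$ with velocity $(\cos\vartheta,\sin\vartheta)$. Let $\mathcal V\subset S$ be the set of singular vertices, i.e. the points of $S$ over the corners $V_k=(k,p_k)$, $k\ge1$, $0<p_k<p_{k-1}$, at which the table has interior angle $3\pi/2$.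 Then for every $\vartheta\in{]0,\pi/2[}$ and every non-periodic point $x\in S$, the closure of the forward semi-orbit of $x$ and the closure of the backward semi-orbit of $x$, taken in the one-point compactification $S\cup\{\infty\}$, both intersect $\mathcal V\cup\{\infty\}$. This holds for every complete non-periodic orbit through $x$, whichever way orbits that hit a singular vertex are continued beyond it. -/

import Mathlib

open Set Filter Topology OnePoint

/-- The table `⋃ n, [n, n + 1] × [0, p n]` of the step billiard with heights `p`. -/
def stepTable (p : ℕ → ℝ) : Set (ℝ × ℝ) :=
  ⋃ n : ℕ, Icc (n : ℝ) (n + 1) ×ˢ Icc 0 (p n)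

/-- The four copies of the table obtained by reflecting it in the two coordinate axes, as a
subset of the plane with coordinates `(X, Y)`. -/
def unfoldedTable (p : ℕ → ℝ) : Set (ℝ × ℝ) :=
  {z | (|z.1|, |z.2|) ∈ stepTable p}

/-- `(x, y)` lies on one of the vertical sides `{n + 1} × [p (n + 1), p n]` of the table (a
side is present at `n + 1` only if the height really drops there). The left wall `x = 0` is not
listed: in the unfolded table its copies already coincide. -/
def OnVerticalSide (p : ℕ → ℝ) (x y : ℝ) : Prop :=
  ∃ n : ℕ, p (n + 1) < p n ∧ x = n + 1 ∧ y ∈ Icc (p (n + 1)) (p n)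

/-- `(x, y)` lies on one of the upper horizontal sides `[n, n + 1] × {p n}` of the table. The
bottom `y = 0` is not listed: in the unfolded table its copies already coincide. -/
def OnHorizontalSide (p : ℕ → ℝ) (x y : ℝ) : Prop :=
  ∃ n : ℕ, x ∈ Icc (n : ℝ) (n + 1) ∧ y = p n

/-- The side identifications of the unfolding: `(X, Y) ∼ (-X, Y)` on vertical sides and
`(X, Y) ∼ (X, -Y)` on horizontal sides. At a corner all four copies are identified. -/
def sideSetoid (p : ℕ → ℝ) : Setoid (unfoldedTable p) where
  r z w := |z.1.1| = |w.1.1| ∧ |z.1.2| = |w.1.2| ∧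
    (z.1.1 = w.1.1 ∨ OnVerticalSide p |z.1.1| |z.1.2|) ∧
    (z.1.2 = w.1.2 ∨ OnHorizontalSide p |z.1.1| |z.1.2|)
  iseqv :=
    { refl := fun _ => ⟨rfl, rfl, Or.inl rfl, Or.inl rfl⟩
      symm := by
        rintro z w ⟨h1, h2, h3, h4⟩
        refine ⟨h1.symm, h2.symm, ?_, ?_⟩
        · rw [← h1, ← h2]; exact h3.imp Eq.symm id
        · rw [← h1, ← h2]; exact h4.imp Eq.symm id
      trans := by
        rintro z w u ⟨h1, h2, h3, h4⟩ ⟨k1, k2, k3, k4⟩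
        rw [← h1, ← h2] at k3 k4
        refine ⟨h1.trans k1, h2.trans k2, ?_, ?_⟩
        · rcases h3 with h3 | h3
          · exact k3.imp (fun h => h3.trans h) id
          · exact Or.inr h3
        · rcases h4 with h4 | h4
          · exact k4.imp (fun h => h4.trans h) id
          · exact Or.inr h4 }

/-- The invariant surface of the billiard flow: the unfolded table with its sides identified,
with the quotient topology. As a topological space it is the same for all directions. -/
abbrev StepSurface (p : ℕ → ℝ) : Type :=
  Quotient (sideSetoid p)

/-- The point of the surface with plane coordinates `z`. -/
def surfacePoint (p : ℕ → ℝ) (z : ℝ × ℝ) (hz : z ∈ unfoldedTable p) : StepSurface p :=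
  Quotient.mk (sideSetoid p) ⟨z, hz⟩

/-- The singular vertices: the points of the surface over the corners `(n + 1, p (n + 1))` of
the table at which the interior angle is `3π/2`. -/
def singularVertices (p : ℕ → ℝ) : Set (StepSurface p) :=
  {v | ∃ (z : ℝ × ℝ) (hz : z ∈ unfoldedTable p), v = surfacePoint p z hz ∧
    ∃ n : ℕ, 0 < p (n + 1) ∧ p (n + 1) < p n ∧ |z.1| = n + 1 ∧ |z.2| = p (n + 1)}

/-- `γ` is a complete orbit of the billiard flow in direction `θ`: at every time it leaves, and
arrives, along a straight segment of the unfolded table in direction `(cos θ, sin θ)`, with unit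
speed. The side identifications produce the elastic reflections. Away from the singular vertices
the continuation is unique; an orbit reaching a singular vertex may go on along any outgoing
segment, so that every convention for continuing such orbits is covered. -/
def IsBilliardOrbit (p : ℕ → ℝ) (θ : ℝ) (γ : ℝ → StepSurface p) : Prop :=
  ∀ t : ℝ,
    (∃ z : ℝ × ℝ, ∃ ε > (0 : ℝ), ∀ s ∈ Icc 0 ε,
      ∃ hz : z + s • (Real.cos θ, Real.sin θ) ∈ unfoldedTable p,
        γ (t + s) = surfacePoint p (z + s • (Real.cos θ, Real.sin θ)) hz) ∧
    (∃ z : ℝ × ℝ, ∃ ε > (0 : ℝ), ∀ s ∈ Icc 0 ε,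
      ∃ hz : z - s • (Real.cos θ, Real.sin θ) ∈ unfoldedTable p,
        γ (t - s) = surfacePoint p (z - s • (Real.cos θ, Real.sin θ)) hz)

/-- The orbit `γ`, hence its starting point `γ 0`, is periodic. -/
def IsPeriodicOrbit (p : ℕ → ℝ) (γ : ℝ → StepSurface p) : Prop :=
  ∃ T > (0 : ℝ), ∀ t : ℝ, γ (t + T) = γ t

/-- The closure of a subset of the surface in the one-point compactification. -/
def closureWithInfinity (p : ℕ → ℝ) (A : Set (StepSurface p)) : Set (OnePoint (StepSurface p)) :=
  closure ((fun v : StepSurface p => (v : OnePoint (StepSurface p))) '' A)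

/-- The set of singular vertices together with the point at infinity. -/
def singularVerticesWithInfinity (p : ℕ → ℝ) : Set (OnePoint (StepSurface p)) :=
  (fun v : StepSurface p => (v : OnePoint (StepSurface p))) '' singularVertices p ∪ {∞}

/-!
In the unfolded table every column `c ≤ X ≤ c + 1` becomes a cylinder when its top is glued to its
bottom, and an orbit crosses it along a straight line, so the orbit is recorded by the columns it
traverses and by its heights on the lines `X ∈ ℤ`. If the closure of a forward semi-orbit misses the
singular vertices and infinity, the semi-orbit stays in finitely many columns and at some distance
`δ` from the vertices. By the pigeonhole principle it comes back to the same line with its height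
changed by some `h`, `|h| < δ`. No vertex separates the orbit from its return, so the two remain
parallel forever and the orbit drifts by `h` at every further return. If `h ≠ 0`, its heights in
each traversed column come within `|h|` of every height, so that no traversed column ends at a
vertex. But a bounded orbit is reflected at some wall, which sends it to the opposite side of the
unfolded table, and it then traverses all columns on its way back, among them one which ends at a
vertex. Hence `h = 0`: the orbit returns exactly, and it is periodic. Rotating the unfolded table by
`π` reverses time and gives the backward semi-orbit.
-/

section Circle

variable {P y z h : ℝ}

theorem norm_coe_eq_abs_of_abs_le (hP : 0 < P) (hy : |y| ≤ P) :
    ‖(y : AddCircle (2 * P))‖ = |y| := by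
  have hP' : 0 < 2 * P := by linarith
  refine (AddCircle.norm_coe_eq_abs_iff (p := 2 * P) hP'.ne').2 ?_
  rwa [abs_of_pos hP', mul_div_cancel_left₀ _ two_ne_zero]

theorem coe_neg_eq_coe_of_abs_eq (hy : |y| = P) : ((-y : ℝ) : AddCircle (2 * P)) = y := by
  rcases abs_choice y with hy' | hy' <;> rw [hy'] at hy
  · rw [← AddCircle.coe_add_period, hy]
    congr 1
    ring
  · rw [← AddCircle.coe_add_period _ y, ← hy]
    congr 1
    ring

theorem abs_eq_abs_of_coe_eq_coe (hP : 0 < P) (hy : |y| ≤ P) (hz : |z| ≤ P)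
    (hyz : (y : AddCircle (2 * P)) = z) : |y| = |z| := by
  rw [← norm_coe_eq_abs_of_abs_le hP hy, hyz, norm_coe_eq_abs_of_abs_le hP hz]

theorem eq_of_coe_eq_coe_of_abs_sub_lt (hyz : (y : AddCircle (2 * P)) = z)
    (hlt : |y - z| < 2 * P) : y = z := by
  have hP : 0 < 2 * P := (abs_nonneg _).trans_lt hlt
  rw [← sub_eq_zero, ← AddCircle.coe_sub, AddCircle.coe_eq_zero_iff] at hyz
  obtain ⟨k, hk⟩ := hyz
  rw [← hk, zsmul_eq_mul, abs_mul, abs_of_pos hP, mul_lt_iff_lt_one_left hP] at hlt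
  have hk0 : k = 0 := Int.abs_lt_one_iff.1 (by exact_mod_cast hlt)
  rw [hk0, zero_smul] at hk
  exact sub_eq_zero.1 hk.symm

theorem eq_or_abs_eq_of_coe_eq_coe (hy : |y| ≤ P) (hz : |z| ≤ P)
    (hyz : (y : AddCircle (2 * P)) = z) : y = z ∨ |y| = P := by
  rw [or_iff_not_imp_right]
  intro hne
  have hlt := hy.lt_of_ne hne
  refine eq_of_coe_eq_coe_of_abs_sub_lt hyz ?_
  linarith [abs_sub y z]

theorem abs_abs_sub_abs_le_of_coe_eq_coe_add (hP : 0 < P) (hy : |y| ≤ P) (hz : |z| ≤ P)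
    (hyz : (y : AddCircle (2 * P)) = ((z + h : ℝ) : AddCircle (2 * P))) :
    |(|y| - |z|)| ≤ |h| := by
  rw [← norm_coe_eq_abs_of_abs_le hP hy, ← norm_coe_eq_abs_of_abs_le hP hz]
  refine (abs_norm_sub_norm_le _ _).trans ?_
  rw [hyz, AddCircle.coe_add, add_sub_cancel_left]
  exact QuotientAddGroup.norm_mk_le_norm

theorem exists_coe_add_nsmul_eq_coe_add {T : ℝ} (hT : 0 < T) (hh : h ≠ 0) (y z : ℝ) :
    ∃ (q : ℕ) (e : ℝ), |e| ≤ |h| ∧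
      ((y + q * h : ℝ) : AddCircle T) = ((z + e : ℝ) : AddCircle T) := by
  wlog hpos : 0 < h generalizing h y z
  · obtain ⟨q, e, he, hq⟩ := this (neg_ne_zero.2 hh) (-y) (-z)
      (neg_pos.2 ((not_lt.1 hpos).lt_of_ne hh))
    refine ⟨q, -e, by rwa [abs_neg, ← abs_neg h], ?_⟩
    have := congrArg Neg.neg hq
    rw [← AddCircle.coe_neg, ← AddCircle.coe_neg] at this
    convert this using 2 <;> ring
  obtain ⟨k, hk⟩ := exists_nat_gt ((y - z) / T)
  rw [div_lt_iff₀ hT] at hk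
  have hfloor := Nat.floor_le (div_nonneg (by linarith : 0 ≤ z + k * T - y) hpos.le)
  have hlt := Nat.lt_floor_add_one ((z + k * T - y) / h)
  set q := ⌊(z + k * T - y) / h⌋₊
  rw [le_div_iff₀ hpos] at hfloor
  rw [div_lt_iff₀ hpos] at hlt
  refine ⟨q, y + q * h - z - k * T, ?_, ?_⟩
  · rw [abs_of_pos hpos, abs_le]
    constructor <;> linarith
  · rw [← sub_eq_zero, ← AddCircle.coe_sub, AddCircle.coe_eq_zero_iff]
    exact ⟨k, by rw [natCast_zsmul, nsmul_eq_mul]; ring⟩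

end Circle

section Columns

variable {p : ℕ → ℝ} {c d : ℤ} {X Y y : ℝ}

/-- The column of the table whose copies in the unfolded table make up the column
`c ≤ X ≤ c + 1`. -/
def columnIndex (c : ℤ) : ℕ :=
  (max c (-(c + 1))).toNat

/-- The half-height of the column `c ≤ X ≤ c + 1` of the unfolded table. -/
def colHeight (p : ℕ → ℝ) (c : ℤ) : ℝ :=
  p (columnIndex c)

/-- The lower end of the vertical sides on the line `X = c + 1`, when there are any. -/
def foot (p : ℕ → ℝ) (c : ℤ) : ℝ :=
  min (colHeight p c) (colHeight p (c + 1))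

/-- There are singular vertices on the line `X = c + 1`, namely at the heights `± foot p c`. -/
def HasVertex (p : ℕ → ℝ) (c : ℤ) : Prop :=
  0 < colHeight p c ∧ 0 < colHeight p (c + 1) ∧ colHeight p c ≠ colHeight p (c + 1)

theorem columnIndex_of_nonneg (hc : 0 ≤ c) : (columnIndex c : ℝ) = c := by
  have : (columnIndex c : ℤ) = c := by rw [columnIndex]; omega
  exact_mod_cast this

theorem columnIndex_of_neg (hc : c < 0) : (columnIndex c : ℝ) = -(c + 1) := by
  have : (columnIndex c : ℤ) = -(c + 1) := by rw [columnIndex]; omega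
  exact_mod_cast this

theorem colHeight_natCast (n : ℕ) : colHeight p n = p n := by
  rw [colHeight, columnIndex]
  congr 1
  omega

theorem colHeight_neg_add_one (p : ℕ → ℝ) (c : ℤ) : colHeight p (-(c + 1)) = colHeight p c := by
  rw [colHeight, colHeight, columnIndex, columnIndex]
  congr 1
  omega

theorem colHeight_le_zero (hp : Antitone p) (c : ℤ) : colHeight p c ≤ p 0 :=
  hp (Nat.zero_le _)

theorem columnIndex_lt_of_colHeight_lt (hp : Antitone p) (h : colHeight p c < colHeight p d) :
    columnIndex d < columnIndex c :=
  hp.reflect_lt h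

theorem nonneg_of_colHeight_succ_lt (hp : Antitone p)
    (h : colHeight p (c + 1) < colHeight p c) : 0 ≤ c := by
  have := columnIndex_lt_of_colHeight_lt hp h
  rw [columnIndex, columnIndex] at this
  omega

theorem neg_of_colHeight_lt_succ (hp : Antitone p)
    (h : colHeight p c < colHeight p (c + 1)) : c < 0 := by
  have := columnIndex_lt_of_colHeight_lt hp h
  rw [columnIndex, columnIndex] at this
  omega

theorem abs_mem_Icc_columnIndex (hX : X ∈ Icc (c : ℝ) (c + 1)) :
    |X| ∈ Icc (columnIndex c : ℝ) (columnIndex c + 1) := by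
  rcases le_or_gt 0 c with hc | hc
  · have : (0 : ℝ) ≤ c := by exact_mod_cast hc
    rw [columnIndex_of_nonneg hc, abs_of_nonneg (this.trans hX.1)]
    exact hX
  · have : (c : ℝ) + 1 ≤ 0 := by exact_mod_cast hc
    rw [columnIndex_of_neg hc, abs_of_nonpos (hX.2.trans this)]
    constructor <;> linarith [hX.1, hX.2]

theorem abs_mem_Ioo_columnIndex (hX : X ∈ Ioo (c : ℝ) (c + 1)) :
    |X| ∈ Ioo (columnIndex c : ℝ) (columnIndex c + 1) := by
  rcases le_or_gt 0 c with hc | hc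
  · have : (0 : ℝ) ≤ c := by exact_mod_cast hc
    rw [columnIndex_of_nonneg hc, abs_of_nonneg (this.trans hX.1.le)]
    exact hX
  · have : (c : ℝ) + 1 ≤ 0 := by exact_mod_cast hc
    rw [columnIndex_of_neg hc, abs_of_nonpos (hX.2.le.trans this)]
    constructor <;> linarith [hX.1, hX.2]

theorem eq_columnIndex {n : ℕ} (hX : X ∈ Ioo (c : ℝ) (c + 1)) (hn : |X| ∈ Icc (n : ℝ) (n + 1)) :
    n = columnIndex c := by
  have h := abs_mem_Ioo_columnIndex hX
  have h₁ : n < columnIndex c + 1 := by exact_mod_cast hn.1.trans_lt h.2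
  have h₂ : columnIndex c < n + 1 := by exact_mod_cast h.1.trans_le hn.2
  omega

theorem mem_unfoldedTable :
    (X, Y) ∈ unfoldedTable p ↔ ∃ n : ℕ, |X| ∈ Icc (n : ℝ) (n + 1) ∧ |Y| ≤ p n := by
  simp [unfoldedTable, stepTable, and_assoc]

theorem mem_unfoldedTable_of_mem_Icc (hX : X ∈ Icc (c : ℝ) (c + 1)) (hY : |Y| ≤ colHeight p c) :
    (X, Y) ∈ unfoldedTable p :=
  mem_unfoldedTable.2 ⟨_, abs_mem_Icc_columnIndex hX, hY⟩

theorem abs_le_colHeight (hX : X ∈ Ioo (c : ℝ) (c + 1)) (h : (X, Y) ∈ unfoldedTable p) :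
    |Y| ≤ colHeight p c := by
  obtain ⟨n, hn, hY⟩ := mem_unfoldedTable.1 h
  rwa [colHeight, ← eq_columnIndex hX hn]

theorem not_onVerticalSide (hX : X ∈ Ioo (c : ℝ) (c + 1)) : ¬ OnVerticalSide p |X| y := by
  rintro ⟨n, -, hn, -⟩
  have h := abs_mem_Ioo_columnIndex hX
  rw [hn] at h
  have h₁ : columnIndex c < n + 1 := by exact_mod_cast h.1
  have h₂ : n < columnIndex c := by exact_mod_cast lt_of_add_lt_add_right h.2
  omega

theorem onHorizontalSide_colHeight (hX : X ∈ Icc (c : ℝ) (c + 1)) :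
    OnHorizontalSide p |X| (colHeight p c) :=
  ⟨_, abs_mem_Icc_columnIndex hX, rfl⟩

theorem OnHorizontalSide.eq_colHeight (h : OnHorizontalSide p |X| y)
    (hX : X ∈ Ioo (c : ℝ) (c + 1)) : y = colHeight p c := by
  obtain ⟨n, hn, hy⟩ := h
  rwa [colHeight, ← eq_columnIndex hX hn]

theorem colHeight_eq_of_abs_eq {n : ℕ} (h : |(c : ℝ) + 1| = n + 1) :
    colHeight p c = p n ∧ colHeight p (c + 1) = p (n + 1) ∨
      colHeight p c = p (n + 1) ∧ colHeight p (c + 1) = p n := by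
  have h' : |c + 1| = n + 1 := by exact_mod_cast h
  rw [abs_eq_max_neg] at h'
  rcases le_or_gt 0 c with hc | hc
  · have h₁ : columnIndex c = n := by rw [columnIndex]; omega
    have h₂ : columnIndex (c + 1) = n + 1 := by rw [columnIndex]; omega
    exact Or.inl ⟨by rw [colHeight, h₁], by rw [colHeight, h₂]⟩
  · have h₁ : columnIndex c = n + 1 := by rw [columnIndex]; omega
    have h₂ : columnIndex (c + 1) = n := by rw [columnIndex]; omega
    exact Or.inr ⟨by rw [colHeight, h₁], by rw [colHeight, h₂]⟩

theorem OnHorizontalSide.eq_or_eq (h : OnHorizontalSide p |(c : ℝ) + 1| y) :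
    y = colHeight p c ∨ y = colHeight p (c + 1) := by
  obtain ⟨n, ⟨hn, hn'⟩, rfl⟩ := h
  have h₁ : n ≤ |c + 1| := by exact_mod_cast hn
  have h₂ : |c + 1| ≤ n + 1 := by exact_mod_cast hn'
  rw [abs_eq_max_neg] at h₁ h₂
  have : n = columnIndex c ∨ n = columnIndex (c + 1) := by
    rw [columnIndex, columnIndex]
    omega
  exact this.imp (congrArg p) (congrArg p)

theorem OnVerticalSide.ne_and_foot_le (h : OnVerticalSide p |(c : ℝ) + 1| y) :
    colHeight p c ≠ colHeight p (c + 1) ∧ foot p c ≤ y := by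
  obtain ⟨n, hlt, hn, hy, -⟩ := h
  rw [foot]
  rcases colHeight_eq_of_abs_eq (p := p) hn with ⟨h₁, h₂⟩ | ⟨h₁, h₂⟩ <;> rw [h₁, h₂]
  · exact ⟨hlt.ne', (min_le_right _ _).trans hy⟩
  · exact ⟨hlt.ne, (min_le_left _ _).trans hy⟩

theorem hasVertex_iff_exists (hp : Antitone p) : HasVertex p c ∧ y = foot p c ↔
    ∃ n : ℕ, 0 < p (n + 1) ∧ p (n + 1) < p n ∧ |(c : ℝ) + 1| = n + 1 ∧ y = p (n + 1) := by
  constructor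
  · rintro ⟨⟨h₁, h₂, hne⟩, hy⟩
    obtain ⟨n, hn⟩ : ∃ n : ℕ, |c + 1| = n + 1 := by
      refine ⟨(|c + 1| - 1).toNat, ?_⟩
      have : c ≠ -1 := by rintro rfl; exact hne rfl
      rw [abs_eq_max_neg]
      omega
    have hn' : |(c : ℝ) + 1| = n + 1 := by exact_mod_cast hn
    have hle := hp n.le_succ
    refine ⟨n, ?_⟩
    rw [foot] at hy
    rcases colHeight_eq_of_abs_eq (p := p) hn' with ⟨h, h'⟩ | ⟨h, h'⟩ <;>
      rw [h, h'] at hne hy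
    · exact ⟨h' ▸ h₂, hle.lt_of_ne hne.symm, hn', hy.trans (min_eq_right hle)⟩
    · exact ⟨h ▸ h₁, hle.lt_of_ne hne, hn', hy.trans (min_eq_left hle)⟩
  · rintro ⟨n, hpos, hlt, hn, hy⟩
    rw [HasVertex, foot, hy]
    rcases colHeight_eq_of_abs_eq (p := p) hn with ⟨h₁, h₂⟩ | ⟨h₁, h₂⟩ <;> rw [h₁, h₂]
    · exact ⟨⟨hpos.trans hlt, hpos, hlt.ne'⟩, (min_eq_right hlt.le).symm⟩
    · exact ⟨⟨hpos, hpos.trans hlt, hlt.ne⟩, (min_eq_left hlt.le).symm⟩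

end Columns

section Coordinates

variable {p : ℕ → ℝ} {q q' : StepSurface p} {c : ℤ} {X Y X' Y' : ℝ}

/-- `(X, Y)` is one of the points of the unfolded table representing the point `q` of the
surface. -/
def HasCoords (p : ℕ → ℝ) (q : StepSurface p) (X Y : ℝ) : Prop :=
  ∃ hz : (X, Y) ∈ unfoldedTable p, q = surfacePoint p (X, Y) hz

theorem HasCoords.mem (h : HasCoords p q X Y) : (X, Y) ∈ unfoldedTable p :=
  h.1

theorem exists_hasCoords (q : StepSurface p) : ∃ X Y, HasCoords p q X Y := by
  obtain ⟨⟨⟨X, Y⟩, hz⟩, rfl⟩ := Quotient.exists_rep q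
  exact ⟨X, Y, hz, rfl⟩

theorem HasCoords.eq_iff (h : HasCoords p q X Y) (h' : HasCoords p q' X' Y') :
    q = q' ↔ |X| = |X'| ∧ |Y| = |Y'| ∧ (X = X' ∨ OnVerticalSide p |X| |Y|) ∧
      (Y = Y' ∨ OnHorizontalSide p |X| |Y|) := by
  obtain ⟨hz, rfl⟩ := h
  obtain ⟨hz', rfl⟩ := h'
  exact Quotient.eq (r := sideSetoid p)

theorem HasCoords.unique (h : HasCoords p q X Y) (h' : HasCoords p q' X Y) : q = q' :=
  (h.eq_iff h').2 ⟨rfl, rfl, Or.inl rfl, Or.inl rfl⟩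

theorem HasCoords.reflect (h : HasCoords p q X Y) (hside : OnVerticalSide p |X| |Y|) :
    HasCoords p q (-X) Y := by
  have hmem : (-X, Y) ∈ unfoldedTable p := by
    rw [mem_unfoldedTable, abs_neg, ← mem_unfoldedTable]
    exact h.mem
  exact ⟨hmem, (h.eq_iff ⟨hmem, rfl⟩).2 ⟨(abs_neg X).symm, rfl, Or.inr hside, Or.inl rfl⟩⟩

theorem HasCoords.fst_eq (h : HasCoords p q X Y) (h' : HasCoords p q X' Y')
    (hX : X ∈ Ioo (c : ℝ) (c + 1)) : X' = X :=
  (((h.eq_iff h').1 rfl).2.2.1.resolve_right (not_onVerticalSide hX)).symm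

theorem HasCoords.coe_snd_eq (h : HasCoords p q X Y) (h' : HasCoords p q X' Y')
    (hX : X ∈ Ioo (c : ℝ) (c + 1)) : (Y' : AddCircle (2 * colHeight p c)) = Y := by
  obtain ⟨-, habs, -, rfl | hY⟩ := (h.eq_iff h').1 rfl
  · rfl
  · rcases abs_eq_abs.1 habs with rfl | rfl
    · rfl
    · rw [abs_neg] at hY
      exact (coe_neg_eq_coe_of_abs_eq (hY.eq_colHeight hX)).symm

theorem HasCoords.eq_of_coe_eq (h : HasCoords p q X Y) (h' : HasCoords p q' X Y')
    (hX : X ∈ Icc (c : ℝ) (c + 1)) (hc : 0 < colHeight p c) (hY : |Y| ≤ colHeight p c)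
    (hY' : |Y'| ≤ colHeight p c) (hYY' : (Y : AddCircle (2 * colHeight p c)) = Y') : q = q' := by
  refine (h.eq_iff h').2
    ⟨rfl, abs_eq_abs_of_coe_eq_coe hc hY hY' hYY', Or.inl rfl, ?_⟩
  refine (eq_or_abs_eq_of_coe_eq_coe hY hY' hYY').imp_right fun hYc => ?_
  rw [hYc]
  exact onHorizontalSide_colHeight hX

theorem HasCoords.mem_singularVertices_iff (h : HasCoords p q X Y) : q ∈ singularVertices p ↔
    ∃ n : ℕ, 0 < p (n + 1) ∧ p (n + 1) < p n ∧ |X| = n + 1 ∧ |Y| = p (n + 1) := by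
  constructor
  · rintro ⟨z, hz, hq, n, hpos, hlt, hX, hY⟩
    obtain ⟨hX', hY', -⟩ := (h.eq_iff ⟨hz, hq⟩).1 rfl
    exact ⟨n, hpos, hlt, hX'.trans hX, hY'.trans hY⟩
  · intro hn
    exact ⟨(X, Y), h.mem, h.2, hn⟩

theorem HasCoords.mem_singularVertices_iff_hasVertex (hp : Antitone p)
    (h : HasCoords p q (c + 1) Y) :
    q ∈ singularVertices p ↔ HasVertex p c ∧ |Y| = foot p c := by
  rw [h.mem_singularVertices_iff, hasVertex_iff_exists hp]

theorem exists_colHeight_lt (hV : (singularVertices p).Nonempty) :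
    ∃ c, 0 < colHeight p c ∧ colHeight p c < colHeight p (c + 1) := by
  obtain ⟨-, -, -, -, n, hpos, hlt, -⟩ := hV
  refine ⟨-((n + 1 : ℕ) + 1), ?_⟩
  rw [colHeight_neg_add_one, colHeight_natCast, Nat.cast_succ, neg_add, neg_add_cancel_right,
    colHeight_neg_add_one, colHeight_natCast]
  exact ⟨hpos, hlt⟩

end Coordinates

section Segments

variable {p : ℕ → ℝ} {a b t : ℝ} {γ : ℝ → StepSurface p} {c : ℤ} {X Y U W : ℝ}

/-- From time `t` on, the path `γ` follows the segment with velocity `(a, b)` issuing from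
`(X, Y)`. -/
def Leaves (p : ℕ → ℝ) (a b : ℝ) (γ : ℝ → StepSurface p) (t X Y : ℝ) : Prop :=
  ∀ᶠ s in 𝓝[≥] t, HasCoords p (γ s) (X + (s - t) * a) (Y + (s - t) * b)

/-- Until time `t` the path `γ` follows the segment with velocity `(a, b)` ending at `(X, Y)`. -/
def Arrives (p : ℕ → ℝ) (a b : ℝ) (γ : ℝ → StepSurface p) (t X Y : ℝ) : Prop :=
  ∀ᶠ s in 𝓝[≤] t, HasCoords p (γ s) (X + (s - t) * a) (Y + (s - t) * b)

/-- The path `γ` is a complete orbit of the billiard flow with velocity `(a, b)`, which need not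
be a unit vector. -/
def IsLinearOrbit (p : ℕ → ℝ) (a b : ℝ) (γ : ℝ → StepSurface p) : Prop :=
  ∀ t, (∃ X Y, Leaves p a b γ t X Y) ∧ ∃ X Y, Arrives p a b γ t X Y

theorem IsBilliardOrbit.isLinearOrbit {θ : ℝ} (h : IsBilliardOrbit p θ γ) :
    IsLinearOrbit p (Real.cos θ) (Real.sin θ) γ := by
  intro t
  obtain ⟨⟨⟨X, Y⟩, ε, hε, hz⟩, ⟨⟨U, W⟩, η, hη, hw⟩⟩ := h t
  refine ⟨⟨X, Y, ?_⟩, U, W, ?_⟩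
  · filter_upwards [Icc_mem_nhdsGE (lt_add_of_pos_right t hε)] with s hs
    have hγs := hz (s - t) ⟨sub_nonneg.2 hs.1, sub_le_iff_le_add'.2 hs.2⟩
    rwa [add_sub_cancel] at hγs
  · filter_upwards [Icc_mem_nhdsLE (sub_lt_self t hη)] with s hs
    have hγs := hw (t - s) ⟨sub_nonneg.2 hs.2, sub_le_comm.1 hs.1⟩
    rwa [sub_sub_cancel, sub_eq_add_neg, ← neg_smul, neg_sub] at hγs

theorem Leaves.hasCoords (h : Leaves p a b γ t X Y) : HasCoords p (γ t) X Y := by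
  simpa using h.self_of_nhdsWithin self_mem_Ici

theorem Arrives.hasCoords (h : Arrives p a b γ t X Y) : HasCoords p (γ t) X Y := by
  simpa using h.self_of_nhdsWithin self_mem_Iic

theorem eventually_mem_column_right (ha : 0 < a) (hX : X ∈ Ico (c : ℝ) (c + 1)) :
    ∀ᶠ s in 𝓝[>] t, X + (s - t) * a ∈ Ioo (c : ℝ) (c + 1) := by
  have hlim : Tendsto (fun s => X + (s - t) * a) (𝓝[>] t) (𝓝 X) :=
    tendsto_nhdsWithin_of_tendsto_nhds (Continuous.tendsto' (by fun_prop) _ _ (by simp))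
  filter_upwards [self_mem_nhdsWithin, hlim.eventually_lt_const hX.2] with s hs hlt
  exact ⟨hX.1.trans_lt (lt_add_of_pos_right _ (mul_pos (sub_pos.2 hs) ha)), hlt⟩

theorem eventually_mem_column_left (ha : 0 < a) (hX : X ∈ Ioc (c : ℝ) (c + 1)) :
    ∀ᶠ s in 𝓝[<] t, X + (s - t) * a ∈ Ioo (c : ℝ) (c + 1) := by
  have hlim : Tendsto (fun s => X + (s - t) * a) (𝓝[<] t) (𝓝 X) :=
    tendsto_nhdsWithin_of_tendsto_nhds (Continuous.tendsto' (by fun_prop) _ _ (by simp))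
  filter_upwards [self_mem_nhdsWithin, hlim.eventually_const_lt hX.1] with s hs hlt
  exact ⟨hlt, (add_lt_of_neg_right _ (mul_neg_of_neg_of_pos (sub_neg.2 hs) ha)).trans_le hX.2⟩

theorem abs_le_colHeight_of_eventually {l : Filter ℝ} [l.NeBot] (hl : l ≤ 𝓝 t)
    (hX : ∀ᶠ s in l, X + (s - t) * a ∈ Ioo (c : ℝ) (c + 1))
    (h : ∀ᶠ s in l, HasCoords p (γ s) (X + (s - t) * a) (Y + (s - t) * b)) :
    |Y| ≤ colHeight p c := by
  have hlim : Tendsto (fun s => |Y + (s - t) * b|) l (𝓝 |Y|) :=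
    (Continuous.tendsto' (by fun_prop) _ _ (by simp)).mono_left hl
  refine le_of_tendsto hlim ?_
  filter_upwards [hX, h] with s hs hq using abs_le_colHeight hs hq.mem

theorem Leaves.abs_le_colHeight (ha : 0 < a) (h : Leaves p a b γ t X Y)
    (hX : X ∈ Ico (c : ℝ) (c + 1)) : |Y| ≤ colHeight p c :=
  abs_le_colHeight_of_eventually nhdsWithin_le_nhds (eventually_mem_column_right ha hX)
    (h.filter_mono (nhdsWithin_mono _ Ioi_subset_Ici_self))

theorem Arrives.abs_le_colHeight (ha : 0 < a) (h : Arrives p a b γ t X Y)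
    (hX : X ∈ Ioc (c : ℝ) (c + 1)) : |Y| ≤ colHeight p c :=
  abs_le_colHeight_of_eventually nhdsWithin_le_nhds (eventually_mem_column_left ha hX)
    (h.filter_mono (nhdsWithin_mono _ Iio_subset_Iic_self))

theorem Leaves.lt_colHeight (ha : 0 < a) (hb : 0 < b) (h : Leaves p a b γ t X Y)
    (hX : X ∈ Ico (c : ℝ) (c + 1)) : Y < colHeight p c := by
  obtain ⟨s, hs, hsX, hsq⟩ := (eventually_mem_nhdsWithin.and
    ((eventually_mem_column_right ha hX).and
      (h.filter_mono (nhdsWithin_mono _ Ioi_subset_Ici_self)))).exists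
  have hY := (le_abs_self _).trans (_root_.abs_le_colHeight hsX hsq.mem)
  exact (lt_add_of_pos_right _ (mul_pos (sub_pos.2 hs) hb)).trans_le hY

theorem Leaves.colHeight_pos (ha : 0 < a) (hb : 0 < b) (h : Leaves p a b γ t X Y)
    (hX : X ∈ Ico (c : ℝ) (c + 1)) : 0 < colHeight p c := by
  linarith [h.lt_colHeight ha hb hX, neg_abs_le Y, h.abs_le_colHeight ha hX]

/-- `q` is the point at abscissa `X` and height `y` of the cylinder obtained from the column
`c ≤ X ≤ c + 1` by glueing its top to its bottom. -/
def HasCylinderCoords (p : ℕ → ℝ) (c : ℤ) (q : StepSurface p) (X : ℝ)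
    (y : AddCircle (2 * colHeight p c)) : Prop :=
  ∃ Y : ℝ, HasCoords p q X Y ∧ Y = y

theorem HasCylinderCoords.eq {q : StepSurface p} {y : AddCircle (2 * colHeight p c)}
    (h : HasCylinderCoords p c q X y) (hX : X ∈ Ioo (c : ℝ) (c + 1)) (h' : HasCoords p q U W) :
    U = X ∧ W = y := by
  obtain ⟨Y, hq, rfl⟩ := h
  exact ⟨hq.fst_eq h' hX, hq.coe_snd_eq h' hX⟩

theorem HasCylinderCoords.of_segment {q q' : StepSurface p} {s s' t' : ℝ}
    (h : HasCylinderCoords p c q (X + (s - t) * a) ↑(Y + (s - t) * b))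
    (hX : X + (s - t) * a ∈ Ioo (c : ℝ) (c + 1))
    (hq : HasCoords p q (U + (s - t') * a) (W + (s - t') * b))
    (hq' : HasCoords p q' (U + (s' - t') * a) (W + (s' - t') * b)) :
    HasCylinderCoords p c q' (X + (s' - t) * a) ↑(Y + (s' - t) * b) := by
  obtain ⟨hU, hW⟩ := h.eq hX hq
  rw [show X + (s' - t) * a = U + (s' - t') * a by linear_combination -hU]
  refine ⟨_, hq', ?_⟩
  have h₁ : W + (s' - t') * b = W + (s - t') * b + (s' - s) * b := by ring
  have h₂ : Y + (s' - t) * b = Y + (s - t) * b + (s' - s) * b := by ring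
  rw [h₁, h₂, AddCircle.coe_add, hW, ← AddCircle.coe_add]

theorem IsLinearOrbit.eventually_hasCylinderCoords_iff (hγ : IsLinearOrbit p a b γ) {s : ℝ}
    (hs : X + (s - t) * a ∈ Ioo (c : ℝ) (c + 1)) :
    ∀ᶠ s' in 𝓝 s, (HasCylinderCoords p c (γ s) (X + (s - t) * a) ↑(Y + (s - t) * b) ↔
      HasCylinderCoords p c (γ s') (X + (s' - t) * a) ↑(Y + (s' - t) * b)) := by
  have hcol : ∀ᶠ s' in 𝓝 s, X + (s' - t) * a ∈ Ioo (c : ℝ) (c + 1) :=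
    (by fun_prop : Continuous fun s' => X + (s' - t) * a).continuousAt.eventually_mem
      (isOpen_Ioo.mem_nhds hs)
  obtain ⟨⟨U, W, hleave⟩, ⟨U', W', harrive⟩⟩ := hγ s
  rw [← nhdsLE_sup_nhdsGE, eventually_sup]
  constructor
  · filter_upwards [harrive, nhdsWithin_le_nhds hcol] with s' h hs'
    exact ⟨fun hγs => hγs.of_segment hs (harrive.self_of_nhdsWithin self_mem_Iic) h,
      fun hγs => hγs.of_segment hs' h (harrive.self_of_nhdsWithin self_mem_Iic)⟩
  · filter_upwards [hleave, nhdsWithin_le_nhds hcol] with s' h hs'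
    exact ⟨fun hγs => hγs.of_segment hs (hleave.self_of_nhdsWithin self_mem_Ici) h,
      fun hγs => hγs.of_segment hs' h (hleave.self_of_nhdsWithin self_mem_Ici)⟩

theorem Leaves.hasCylinderCoords (hγ : IsLinearOrbit p a b γ) (ha : 0 < a)
    (h : Leaves p a b γ t X Y) (hX : X ∈ Ico (c : ℝ) (c + 1)) {s : ℝ}
    (hs : s ∈ Ioo t (t + (c + 1 - X) / a)) :
    HasCylinderCoords p c (γ s) (X + (s - t) * a) ↑(Y + (s - t) * b) := by
  have hcol : ∀ r ∈ Ioo t (t + (c + 1 - X) / a), X + (r - t) * a ∈ Ioo (c : ℝ) (c + 1) := by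
    intro r hr
    have := (lt_div_iff₀ ha).1 (sub_lt_iff_lt_add'.2 hr.2)
    exact ⟨hX.1.trans_lt (lt_add_of_pos_right _ (mul_pos (sub_pos.2 hr.1) ha)), by linarith⟩
  have hsub : ∀ᶠ s in 𝓝[>] t, s ∈ Ioo t (t + (c + 1 - X) / a) :=
    Ioo_mem_nhdsGT (lt_add_of_pos_right t (div_pos (sub_pos.2 hX.2) ha))
  obtain ⟨r, hrT, hr⟩ :=
    (hsub.and (h.filter_mono (nhdsWithin_mono _ Ioi_subset_Ici_self))).exists
  refine (isPreconnected_Ioo.induction₂ (fun r s =>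
    HasCylinderCoords p c (γ r) (X + (r - t) * a) ↑(Y + (r - t) * b) ↔
      HasCylinderCoords p c (γ s) (X + (s - t) * a) ↑(Y + (s - t) * b)) ?_ ?_ ?_ hrT hs).1
        ⟨_, hr, rfl⟩
  · intro r hr
    exact nhdsWithin_le_nhds (hγ.eventually_hasCylinderCoords_iff (hcol r hr))
  · exact fun _ _ _ _ _ _ => Iff.trans
  · exact fun _ _ _ _ => Iff.symm

theorem Leaves.eq_of_arrives (hγ : IsLinearOrbit p a b γ) (ha : 0 < a)
    (h : Leaves p a b γ t X Y) (hX : X ∈ Ico (c : ℝ) (c + 1))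
    (h' : Arrives p a b γ (t + (c + 1 - X) / a) U W) :
    U = c + 1 ∧ (W : AddCircle (2 * colHeight p c)) = ↑(Y + (c + 1 - X) / a * b) := by
  set T := (c + 1 - X) / a
  have hTa : T * a = c + 1 - X := div_mul_cancel₀ _ ha.ne'
  have hTpos : 0 < T := div_pos (sub_pos.2 hX.2) ha
  have hsub : ∀ᶠ s in 𝓝[<] (t + T), s ∈ Ioo t (t + T) :=
    Ioo_mem_nhdsLT (lt_add_of_pos_right t hTpos)
  obtain ⟨s, hs, hsq⟩ :=
    (hsub.and (h'.filter_mono (nhdsWithin_mono _ Iio_subset_Iic_self))).exists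
  have hcol : X + (s - t) * a ∈ Ioo (c : ℝ) (c + 1) := by
    constructor <;> nlinarith [hX.1, mul_pos (sub_pos.2 hs.1) ha, mul_pos (sub_pos.2 hs.2) ha]
  obtain ⟨hU, hW⟩ := (h.hasCylinderCoords hγ ha hX hs).eq hcol hsq
  refine ⟨by linear_combination hU + hTa, ?_⟩
  have h₁ : W = W + (s - (t + T)) * b + (t + T - s) * b := by ring
  have h₂ : Y + T * b = Y + (s - t) * b + (t + T - s) * b := by ring
  rw [h₂, h₁, AddCircle.coe_add, hW, ← AddCircle.coe_add]

end Segments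

section LineCrossing

variable {p : ℕ → ℝ} {q : StepSurface p} {c c' : ℤ} {Y Y' : ℝ}

theorem HasCoords.eq_zero_or_eq_colHeight (hp : Antitone p) (h : HasCoords p q (c + 1) Y)
    (hq : q ∉ singularVertices p) (hY : |Y| ≤ colHeight p (c + 1))
    (hside : OnHorizontalSide p |(c : ℝ) + 1| |Y|) : Y = 0 ∨ |Y| = colHeight p (c + 1) := by
  rw [or_iff_not_imp_right]
  intro hne
  have hYc := hside.eq_or_eq.resolve_right hne
  by_contra hY0
  rw [h.mem_singularVertices_iff_hasVertex hp] at hq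
  have hlt := hY.lt_of_ne hne
  have hpos := abs_pos.2 hY0
  rw [hYc] at hlt hpos
  exact hq ⟨⟨hpos, hpos.trans hlt, hlt.ne⟩, hYc.trans (min_eq_left hlt.le).symm⟩

theorem HasCoords.coe_eq_of_notMem (hp : Antitone p) (h : HasCoords p q c Y)
    (h' : HasCoords p q c Y') (hq : q ∉ singularVertices p) (hY : |Y| ≤ colHeight p c) :
    (Y' : AddCircle (2 * colHeight p c)) = Y := by
  obtain ⟨c, rfl⟩ : ∃ d, c = d + 1 := ⟨c - 1, (sub_add_cancel c 1).symm⟩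
  push_cast at h h'
  obtain ⟨-, habs, -, rfl | hside⟩ := (h.eq_iff h').1 rfl
  · rfl
  rcases abs_eq_abs.1 habs with rfl | rfl
  · rfl
  rcases h.eq_zero_or_eq_colHeight hp hq hY hside with h0 | hYc
  · rw [neg_eq_zero.1 h0, neg_zero]
  · rw [← coe_neg_eq_coe_of_abs_eq hYc, neg_neg]

theorem HasCoords.column_eq_of_notMem (hp : Antitone p) (h : HasCoords p q c Y)
    (h' : HasCoords p q c' Y') (hq : q ∉ singularVertices p) (hc : 0 < colHeight p c)
    (hc' : 0 < colHeight p c') (hY : |Y| ≤ colHeight p c) (hY' : |Y'| ≤ colHeight p c') :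
    c' = c := by
  obtain ⟨c, rfl⟩ : ∃ d, c = d + 1 := ⟨c - 1, (sub_add_cancel c 1).symm⟩
  push_cast at h
  obtain ⟨habs, habsY, hcc' | hside, -⟩ := (h.eq_iff h').1 rfl
  · exact_mod_cast hcc'.symm
  obtain ⟨hne, hfoot⟩ := hside.ne_and_foot_le
  rcases abs_eq_abs.1 habs with hcc' | hcc'
  · exact_mod_cast hcc'.symm
  obtain rfl : c' = -(c + 1) := by
    have : ((c + 1 : ℤ) : ℝ) = ((-c' : ℤ) : ℝ) := by exact_mod_cast hcc'
    rw [Int.cast_inj.1 this, neg_neg]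
  rw [colHeight_neg_add_one] at hc' hY'
  rw [← habsY] at hY'
  exact absurd ((h.mem_singularVertices_iff_hasVertex hp).2
    ⟨⟨hc', hc, hne⟩, (le_min hY' hY).antisymm hfoot⟩) hq

theorem HasCoords.crossing (hp : Antitone p) (h : HasCoords p q (c + 1) Y)
    (h' : HasCoords p q c' Y') (hq : q ∉ singularVertices p) (hc' : 0 < colHeight p c')
    (hY : |Y| ≤ colHeight p c) (hY' : |Y'| ≤ colHeight p c') :
    (Y' : AddCircle (2 * colHeight p c')) = Y ∧ (c' = c + 1 ∨
      c' = -(c + 1) ∧ colHeight p (c + 1) < colHeight p c ∧ colHeight p (c + 1) ≤ |Y|) := by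
  obtain ⟨habs, habsY, hside, -⟩ := (h.eq_iff h').1 rfl
  rw [← habsY] at hY'
  by_cases hcc' : c' = c + 1
  · subst hcc'
    rw [← Int.cast_one, ← Int.cast_add] at h
    exact ⟨h.coe_eq_of_notMem hp h' hq hY', Or.inl rfl⟩
  have hcast : (c : ℝ) + 1 ≠ c' := by exact_mod_cast Ne.symm hcc'
  obtain rfl : c' = -(c + 1) := by
    have : ((c + 1 : ℤ) : ℝ) = ((-c' : ℤ) : ℝ) := by
      exact_mod_cast (abs_eq_abs.1 habs).resolve_left hcast
    rw [Int.cast_inj.1 this, neg_neg]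
  have hwall := hside.resolve_left hcast
  obtain ⟨hne, hfoot⟩ := hwall.ne_and_foot_le
  have hlt : colHeight p (c + 1) < colHeight p c := by
    refine hne.symm.lt_of_le (le_of_not_gt fun hgt => hq ?_)
    rw [colHeight_neg_add_one] at hc'
    rw [foot, min_eq_left hgt.le] at hfoot
    rw [h.mem_singularVertices_iff_hasVertex hp, foot, min_eq_left hgt.le]
    exact ⟨⟨hc', hc'.trans hgt, hne⟩, hY.antisymm hfoot⟩
  rw [foot, min_eq_right hlt.le] at hfoot
  have hreflect := h.reflect hwall
  rw [← Int.cast_one, ← Int.cast_add, ← Int.cast_neg] at hreflect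
  exact ⟨hreflect.coe_eq_of_notMem hp h' hq hY', Or.inr ⟨rfl, hlt, hfoot⟩⟩

end LineCrossing

section ColumnDynamics

variable {p : ℕ → ℝ} {m δ h V V' W W' : ℝ} {c c' d d' : ℤ}

/-- The transition between two consecutive crossings of the lines `X ∈ ℤ`. An orbit reaching the
line `X = c + 1` at height `V` through the column `c` traverses next the column `c'`, at whose
right end it has height `V'`; the vertical displacement across a column is `m`. -/
structure ColumnStep (p : ℕ → ℝ) (m : ℝ) (c : ℤ) (V : ℝ) (c' : ℤ) (V' : ℝ) : Prop where
  pos : 0 < colHeight p c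
  pos_next : 0 < colHeight p c'
  abs_le : |V| ≤ colHeight p c
  abs_le_next : |V| ≤ colHeight p c'
  coe_eq : (V' : AddCircle (2 * colHeight p c')) = ↑(V + m)
  next : c' = c + 1 ∨
    c' = -(c + 1) ∧ colHeight p (c + 1) < colHeight p c ∧ colHeight p (c + 1) ≤ |V|

/-- The point at height `V` of the line `X = c + 1` is at distance at least `δ` from the singular
vertices on that line. -/
def AvoidsVertex (p : ℕ → ℝ) (δ : ℝ) (c : ℤ) (V : ℝ) : Prop :=
  HasVertex p c → δ ≤ |(|V| - foot p c)|

theorem ColumnStep.next_eq_of_neg (hp : Antitone p) (h : ColumnStep p m c V c' V') (hc : c < 0) :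
    c' = c + 1 :=
  h.next.resolve_right fun hr => hc.not_ge (nonneg_of_colHeight_succ_lt hp hr.2.1)

theorem ColumnStep.abs_le_foot_sub (h : ColumnStep p m c V (c + 1) V') (hv : HasVertex p c)
    (ha : AvoidsVertex p δ c V) : |V| ≤ foot p c - δ := by
  have hfoot : |V| ≤ foot p c := le_min h.abs_le h.abs_le_next
  have hδ := ha hv
  rw [abs_of_nonpos (sub_nonpos.2 hfoot)] at hδ
  linarith

theorem ColumnStep.foot_add_le (h : ColumnStep p m c V c' V') (hc' : c' ≠ c + 1)
    (hv : HasVertex p c) (ha : AvoidsVertex p δ c V) : foot p c + δ ≤ |V| := by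
  obtain ⟨-, hlt, hle⟩ := h.next.resolve_left hc'
  have hδ := ha hv
  rw [foot, min_eq_right hlt.le] at hδ ⊢
  rw [abs_of_nonneg (sub_nonneg.2 hle)] at hδ
  linarith

theorem ColumnStep.next_eq (h₁ : ColumnStep p m c V d V') (h₂ : ColumnStep p m c W d' W')
    (hδ : |h| < δ) (hV : AvoidsVertex p δ c V) (hW : AvoidsVertex p δ c W)
    (hVW : (W : AddCircle (2 * colHeight p c)) = ↑(V + h)) : d' = d := by
  have hclose := abs_abs_sub_abs_le_of_coe_eq_coe_add h₁.pos h₂.abs_le h₁.abs_le hVW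
  have hδ0 := (abs_nonneg h).trans_lt hδ
  rcases h₁.next with rfl | ⟨rfl, hlt, -⟩ <;> rcases h₂.next with rfl | ⟨rfl, hlt', -⟩
  · rfl
  · by_contra hne
    have hv : HasVertex p c := ⟨h₁.pos, h₁.pos_next, hlt'.ne'⟩
    linarith [h₁.abs_le_foot_sub hv hV, h₂.foot_add_le hne hv hW, le_abs_self (|W| - |V|)]
  · by_contra hne
    have hv : HasVertex p c := ⟨h₁.pos, h₂.pos_next, hlt.ne'⟩
    linarith [h₂.abs_le_foot_sub hv hW, h₁.foot_add_le (Ne.symm hne) hv hV,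
      neg_abs_le (|W| - |V|)]
  · rfl

theorem ColumnStep.coe_eq_add (h₁ : ColumnStep p m c V d V') (h₂ : ColumnStep p m c W d W')
    (hδ : |h| < δ) (hV : AvoidsVertex p δ c V) (hW : AvoidsVertex p δ c W)
    (hVW : (W : AddCircle (2 * colHeight p c)) = ↑(V + h)) :
    (W' : AddCircle (2 * colHeight p d)) = ↑(V' + h) := by
  have hcross : (W : AddCircle (2 * colHeight p d)) = ↑(V + h) := by
    by_cases hd : colHeight p d = colHeight p c
    · rwa [hd]
    obtain rfl : d = c + 1 := by
      refine h₁.next.resolve_right fun hr => hd ?_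
      rw [hr.1, colHeight_neg_add_one]
    have hv : HasVertex p c := ⟨h₁.pos, h₁.pos_next, Ne.symm hd⟩
    have hlt : |W - (V + h)| < 2 * colHeight p c := by
      have : foot p c ≤ colHeight p c := min_le_left _ _
      linarith [abs_sub W (V + h), abs_add_le V h, abs_nonneg h, h₁.abs_le_foot_sub hv hV,
        h₂.abs_le_foot_sub hv hW]
    rw [eq_of_coe_eq_coe_of_abs_sub_lt hVW hlt]
  rw [h₂.coe_eq, AddCircle.coe_add, hcross, AddCircle.coe_add, AddCircle.coe_add, h₁.coe_eq,
    AddCircle.coe_add, add_right_comm]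

/-- An infinite sequence of column transitions, through the columns `C n` with heights `v n` at
their right ends. -/
def IsItinerary (p : ℕ → ℝ) (m : ℝ) (C : ℕ → ℤ) (v : ℕ → ℝ) : Prop :=
  ∀ n, ColumnStep p m (C n) (v n) (C (n + 1)) (v (n + 1))

variable {C D : ℕ → ℤ} {v w : ℕ → ℝ} {N : ℤ}

theorem IsItinerary.comp_add (hC : IsItinerary p m C v) (T : ℕ) :
    IsItinerary p m (fun n => C (n + T)) (fun n => v (n + T)) := fun n => by
  simpa only [add_right_comm] using hC (n + T)

theorem parallel_of_isItinerary (hC : IsItinerary p m C v)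
    (hD : IsItinerary p m D w) (hδ : |h| < δ)
    (hv : ∀ n, AvoidsVertex p δ (C n) (v n)) (hw : ∀ n, AvoidsVertex p δ (D n) (w n))
    (h₀ : D 0 = C 0) (hvw : (w 0 : AddCircle (2 * colHeight p (C 0))) = ↑(v 0 + h)) (n : ℕ) :
    D n = C n ∧ (w n : AddCircle (2 * colHeight p (C n))) = ↑(v n + h) := by
  induction n with
  | zero => exact ⟨h₀, hvw⟩
  | succ n ih =>
    obtain ⟨hn, ih⟩ := ih
    have hDn := hD n
    have hwn := hw n
    rw [hn] at hDn hwn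
    have hnext := (hC n).next_eq hDn hδ (hv n) hwn ih
    rw [hnext] at hDn
    exact ⟨hnext, (hC n).coe_eq_add hDn hδ (hv n) hwn ih⟩

theorem drift_of_isItinerary (hC : IsItinerary p m C v)
    (hδ : |h| < δ) (hv : ∀ n, AvoidsVertex p δ (C n) (v n)) {T : ℕ} (hT : C T = C 0)
    (hvT : (v T : AddCircle (2 * colHeight p (C 0))) = ↑(v 0 + h)) (n q : ℕ) :
    C (n + q * T) = C n ∧
      (v (n + q * T) : AddCircle (2 * colHeight p (C n))) = ↑(v n + q * h) := by
  have hparallel : ∀ n, C (n + T) = C n ∧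
      (v (n + T) : AddCircle (2 * colHeight p (C n))) = ↑(v n + h) :=
    parallel_of_isItinerary hC (hC.comp_add T) hδ hv (fun n => hv (n + T))
      (by rwa [zero_add]) (by rwa [zero_add])
  induction q with
  | zero => simp
  | succ q ih =>
    obtain ⟨hq, ih⟩ := ih
    obtain ⟨hq', hvq⟩ := hparallel (n + q * T)
    rw [hq] at hq' hvq
    rw [Nat.succ_mul, ← add_assoc]
    refine ⟨hq', ?_⟩
    rw [hvq, AddCircle.coe_add, ih, ← AddCircle.coe_add, Nat.cast_succ, add_one_mul, ← add_assoc]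

theorem not_hasVertex_of_drift (hC : IsItinerary p m C v)
    (hδ : |h| < δ) (hv : ∀ n, AvoidsVertex p δ (C n) (v n)) {T : ℕ} (hT : C T = C 0)
    (hvT : (v T : AddCircle (2 * colHeight p (C 0))) = ↑(v 0 + h)) (hh : h ≠ 0) (n : ℕ) :
    ¬ HasVertex p (C n) := by
  intro hvert
  have hpos := (hC n).pos
  obtain ⟨q, e, he, hq⟩ := exists_coe_add_nsmul_eq_coe_add (mul_pos two_pos hpos) hh
    (v n) (foot p (C n))
  obtain ⟨hcol, hdrift⟩ := drift_of_isItinerary hC hδ hv hT hvT n q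
  have hfoot : 0 < foot p (C n) := lt_min hvert.1 hvert.2.1
  have havoid := hv (n + q * T)
  have hle := (hC (n + q * T)).abs_le
  rw [hcol] at havoid hle
  have hclose := abs_abs_sub_abs_le_of_coe_eq_coe_add hpos hle
    ((abs_of_pos hfoot).trans_le (min_le_left _ _)) (hdrift.trans hq)
  rw [abs_of_pos hfoot] at hclose
  exact absurd (havoid hvert) (not_le.2 ((hclose.trans he).trans_lt hδ))

theorem exists_next_ne (hN : ∀ n, C n ≤ N) : ∃ n, C (n + 1) ≠ C n + 1 := by
  by_contra! hstraight
  have hC : ∀ n : ℕ, C n = C 0 + n := by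
    intro n
    induction n with
    | zero => simp
    | succ n ih => rw [hstraight, ih]; push_cast; ring
  have h₁ := hN (N - C 0 + 1).toNat
  have h₂ := hN 0
  rw [hC] at h₁
  omega

theorem exists_column_eq_of_neg (hp : Antitone p)
    (hC : IsItinerary p m C v) {n : ℕ} (hn : C n ≤ c)
    (hc : c < 0) : ∃ k, C k = c := by
  have hclimb : ∀ j : ℕ, C n + j ≤ c → C (n + j) = C n + j := by
    intro j
    induction j with
    | zero => simp
    | succ j ih =>
      intro hj
      push_cast at hj ⊢
      have hj' := ih (by omega)
      rw [← add_assoc, (hC (n + j)).next_eq_of_neg hp (by omega), hj']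
      ring
  exact ⟨n + (c - C n).toNat, by rw [hclimb _ (by omega)]; omega⟩

theorem exists_hasVertex_column (hp : Antitone p)
    (hC : IsItinerary p m C v) (hN : ∀ n, C n ≤ N)
    (hc : 0 < colHeight p c) (hlt : colHeight p c < colHeight p (c + 1)) :
    ∃ n, HasVertex p (C n) := by
  by_contra! hnone
  obtain ⟨n, hn⟩ := exists_next_ne hN
  obtain ⟨hreflect, hdrop, -⟩ := (hC n).next.resolve_left hn
  have hwall : colHeight p (C n + 1) ≤ 0 :=
    le_of_not_gt fun hpos => hnone n ⟨(hC n).pos, hpos, hdrop.ne'⟩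
  have hneg := neg_of_colHeight_lt_succ hp hlt
  have hle : C (n + 1) ≤ c := by
    have hindex := columnIndex_lt_of_colHeight_lt hp (hwall.trans_lt hc)
    have hnonneg := nonneg_of_colHeight_succ_lt hp hdrop
    rw [columnIndex, columnIndex] at hindex
    omega
  obtain ⟨k, rfl⟩ := exists_column_eq_of_neg hp hC hle hneg
  exact hnone k ⟨hc, hc.trans hlt, hlt.ne⟩

theorem eq_zero_of_return (hp : Antitone p)
    (hC : IsItinerary p m C v) (hN : ∀ n, C n ≤ N)
    (hc : 0 < colHeight p c) (hlt : colHeight p c < colHeight p (c + 1))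
    (hδ : |h| < δ) (hv : ∀ n, AvoidsVertex p δ (C n) (v n)) {T : ℕ} (hT : C T = C 0)
    (hvT : (v T : AddCircle (2 * colHeight p (C 0))) = ↑(v 0 + h)) : h = 0 := by
  by_contra hh
  obtain ⟨n, hn⟩ := exists_hasVertex_column hp hC hN hc hlt
  exact not_hasVertex_of_drift hC hδ hv hT hvT hh n hn

end ColumnDynamics

section Return

variable {p : ℕ → ℝ} {a b t : ℝ} {γ γ' : ℝ → StepSurface p} {q : StepSurface p} {c : ℤ}
  {X Y U V W : ℝ}

/-- The point `q` lies on one of the lines `X ∈ ℤ`. -/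
def OnGridLine (p : ℕ → ℝ) (q : StepSurface p) : Prop :=
  ∃ (c : ℤ) (Y : ℝ), HasCoords p q c Y

theorem OnGridLine.exists_leaves (h : OnGridLine p (γ t)) (hγ : IsLinearOrbit p a b γ) :
    ∃ (c : ℤ) (Y : ℝ), Leaves p a b γ t c Y := by
  obtain ⟨c, Y, hq⟩ := h
  obtain ⟨U, W, hleave⟩ := (hγ t).1
  rcases abs_eq_abs.1 ((hleave.hasCoords.eq_iff hq).1 rfl).1 with rfl | rfl
  · exact ⟨c, W, hleave⟩
  · exact ⟨-c, W, by rwa [Int.cast_neg]⟩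

theorem Leaves.eq_of_arrives_of_intCast (hγ : IsLinearOrbit p a b γ) (ha : 0 < a)
    (h : Leaves p a b γ t c Y) (h' : Arrives p a b γ (t + 1 / a) U W) :
    U = c + 1 ∧ (W : AddCircle (2 * colHeight p c)) = ↑(Y + b / a) := by
  have := h.eq_of_arrives (U := U) (W := W) hγ ha ⟨le_rfl, lt_add_one _⟩
  rw [add_sub_cancel_left, one_div_mul_eq_div] at this
  exact this h'

theorem Arrives.exists_columnStep (hp : Antitone p) (hγ : IsLinearOrbit p a b γ) (ha : 0 < a)
    (hb : 0 < b) (h : Arrives p a b γ t (c + 1) V) (hq : γ t ∉ singularVertices p)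
    (hc : 0 < colHeight p c) (h' : Arrives p a b γ (t + 1 / a) U W) :
    ∃ c' : ℤ, U = c' + 1 ∧ ColumnStep p (b / a) c V c' W := by
  obtain ⟨c', Y, hleave⟩ := OnGridLine.exists_leaves
    ⟨c + 1, V, by simpa only [Int.cast_add, Int.cast_one] using h.hasCoords⟩ hγ
  have hcol : (c' : ℝ) ∈ Ico (c' : ℝ) (c' + 1) := ⟨le_rfl, lt_add_one _⟩
  have hV := h.abs_le_colHeight ha ⟨lt_add_one (c : ℝ), le_rfl⟩
  have hY := hleave.abs_le_colHeight ha hcol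
  have hc' := hleave.colHeight_pos ha hb hcol
  obtain ⟨hU, hW⟩ := hleave.eq_of_arrives_of_intCast hγ ha h'
  obtain ⟨hYV, hnext⟩ := h.hasCoords.crossing hp hleave.hasCoords hq hc' hV hY
  have habs := ((h.hasCoords.eq_iff hleave.hasCoords).1 rfl).2.1
  exact ⟨c', hU, hc, hc', hV, habs.trans_le hY,
    by rw [hW, AddCircle.coe_add, hYV, ← AddCircle.coe_add], hnext⟩

theorem IsLinearOrbit.exists_isItinerary (hp : Antitone p) (hγ : IsLinearOrbit p a b γ)
    (ha : 0 < a) (hb : 0 < b) (hns : ∀ t ≥ 0, γ t ∉ singularVertices p) :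
    ∃ t₀ ≥ 0, ∃ C v, IsItinerary p (b / a) C v ∧
      ∀ n : ℕ, HasCoords p (γ (t₀ + n * (1 / a))) (C n + 1) (v n) := by
  obtain ⟨X, Y, hleave⟩ := (hγ 0).1
  have hX : X ∈ Ico (⌊X⌋ : ℝ) (⌊X⌋ + 1) := ⟨Int.floor_le X, Int.lt_floor_add_one X⟩
  set t₀ := (⌊X⌋ + 1 - X) / a
  have ht₀ : 0 ≤ t₀ := div_nonneg (sub_nonneg.2 hX.2.le) ha.le
  choose U v harrive using fun n : ℕ => (hγ (t₀ + n * (1 / a))).2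
  have hstep : ∀ (n : ℕ) (c : ℤ), U n = c + 1 → 0 < colHeight p c →
      ∃ c' : ℤ, U (n + 1) = c' + 1 ∧ ColumnStep p (b / a) c (v n) c' (v (n + 1)) := by
    intro n c hU hc
    refine Arrives.exists_columnStep hp hγ ha hb (hU ▸ harrive n) (hns _ (by positivity)) hc ?_
    have := harrive (n + 1)
    rwa [Nat.cast_succ, add_one_mul, ← add_assoc] at this
  have hcolumn : ∀ n, ∃ c : ℤ, U n = c + 1 ∧ 0 < colHeight p c := by
    intro n
    induction n with
    | zero =>
      refine ⟨⌊X⌋, (hleave.eq_of_arrives (W := v 0) hγ ha hX ?_).1, hleave.colHeight_pos ha hb hX⟩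
      simpa [t₀] using harrive 0
    | succ n ih =>
      obtain ⟨c, hU, hc⟩ := ih
      obtain ⟨c', hU', hc'⟩ := hstep n c hU hc
      exact ⟨c', hU', hc'.pos_next⟩
  choose C hC hpos using hcolumn
  refine ⟨t₀, ht₀, C, v, fun n => ?_, fun n => hC n ▸ (harrive n).hasCoords⟩
  obtain ⟨c', hU, hc'⟩ := hstep n _ (hC n) (hpos n)
  rw [hC (n + 1), add_left_inj, Int.cast_inj] at hU
  rwa [← hU] at hc'

theorem HasCylinderCoords.unique {q' : StepSurface p} {y : AddCircle (2 * colHeight p c)}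
    (h : HasCylinderCoords p c q X y) (h' : HasCylinderCoords p c q' X y)
    (hX : X ∈ Ioo (c : ℝ) (c + 1)) (hc : 0 < colHeight p c) : q = q' := by
  obtain ⟨Y, hq, rfl⟩ := h
  obtain ⟨Y', hq', hY'⟩ := h'
  exact hq.eq_of_coe_eq hq' ⟨hX.1.le, hX.2.le⟩ hc (abs_le_colHeight hX hq.mem)
    (abs_le_colHeight hX hq'.mem) hY'.symm

theorem IsLinearOrbit.onGridLine_add (hγ : IsLinearOrbit p a b γ) (ha : 0 < a)
    (h : OnGridLine p (γ t)) : OnGridLine p (γ (t + 1 / a)) := by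
  obtain ⟨c, Y, hleave⟩ := h.exists_leaves hγ
  obtain ⟨U, W, harrive⟩ := (hγ (t + 1 / a)).2
  obtain ⟨rfl, -⟩ := hleave.eq_of_arrives_of_intCast hγ ha harrive
  exact ⟨c + 1, W, by simpa only [Int.cast_add, Int.cast_one] using harrive.hasCoords⟩

theorem IsLinearOrbit.eqOn_Icc (hp : Antitone p) (hγ : IsLinearOrbit p a b γ)
    (hγ' : IsLinearOrbit p a b γ') (ha : 0 < a) (hb : 0 < b) (h : γ t = γ' t)
    (hgrid : OnGridLine p (γ t)) (hq : γ t ∉ singularVertices p) :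
    EqOn γ γ' (Icc t (t + 1 / a)) := by
  obtain ⟨c, Y, hl⟩ := hgrid.exists_leaves hγ
  obtain ⟨c', Y', hl'⟩ := (h ▸ hgrid : OnGridLine p (γ' t)).exists_leaves hγ'
  have hcol (c : ℤ) : (c : ℝ) ∈ Ico (c : ℝ) (c + 1) := ⟨le_rfl, lt_add_one _⟩
  have hc := hl.colHeight_pos ha hb (hcol c)
  have hY := hl.abs_le_colHeight ha (hcol c)
  have hcoords : HasCoords p (γ t) c' Y' := h ▸ hl'.hasCoords
  obtain rfl := hl.hasCoords.column_eq_of_notMem hp hcoords hq hc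
    (hl'.colHeight_pos ha hb (hcol c')) hY (hl'.abs_le_colHeight ha (hcol c'))
  have hYY' := hl.hasCoords.coe_eq_of_notMem hp hcoords hq hY
  intro s hs
  rcases eq_endpoints_or_mem_Ioo_of_mem_Icc hs with rfl | rfl | hs
  · exact h
  · obtain ⟨U, W, har⟩ := (hγ (t + 1 / a)).2
    obtain ⟨U', W', har'⟩ := (hγ' (t + 1 / a)).2
    obtain ⟨rfl, hW⟩ := hl.eq_of_arrives_of_intCast hγ ha har
    obtain ⟨rfl, hW'⟩ := hl'.eq_of_arrives_of_intCast hγ' ha har'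
    have hcol' : (c' : ℝ) + 1 ∈ Ioc (c' : ℝ) (c' + 1) := ⟨lt_add_one _, le_rfl⟩
    refine har.hasCoords.eq_of_coe_eq har'.hasCoords ⟨hcol'.1.le, hcol'.2⟩ hc
      (har.abs_le_colHeight ha hcol') (har'.abs_le_colHeight ha hcol') ?_
    rw [hW, hW', AddCircle.coe_add, AddCircle.coe_add, hYY']
  · have hs' : s ∈ Ioo t (t + (c' + 1 - c') / a) := by rwa [add_sub_cancel_left]
    have hcyl := hl.hasCylinderCoords hγ ha (hcol c') hs'
    have hcyl' := hl'.hasCylinderCoords hγ' ha (hcol c') hs'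
    rw [AddCircle.coe_add, hYY', ← AddCircle.coe_add] at hcyl'
    have hsa := (lt_div_iff₀ ha).1 (sub_lt_iff_lt_add'.2 hs.2)
    exact hcyl.unique hcyl'
      ⟨lt_add_of_pos_right _ (mul_pos (sub_pos.2 hs.1) ha), by linarith⟩ hc

end Return

section Reversal

variable {p : ℕ → ℝ} {a b t X Y : ℝ} {γ γ' : ℝ → StepSurface p} {q : StepSurface p}

/-- The rotation by `π` of the unfolded table, which exchanges forward and backward orbits. -/
def rotateSurface (p : ℕ → ℝ) : StepSurface p → StepSurface p :=
  Quotient.map (fun z => ⟨(-z.1.1, -z.1.2), by simpa [unfoldedTable] using z.2⟩) <| by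
    rintro z w ⟨habs₁, habs₂, h₁, h₂⟩
    refine ⟨by simpa using habs₁, by simpa using habs₂, ?_, ?_⟩
    · simpa using h₁
    · simpa using h₂

theorem continuous_rotateSurface : Continuous (rotateSurface p) :=
  Continuous.quotient_map' (by fun_prop) _

theorem HasCoords.rotate (h : HasCoords p q X Y) :
    HasCoords p (rotateSurface p q) (-X) (-Y) := by
  obtain ⟨hz, rfl⟩ := h
  exact ⟨by simpa [unfoldedTable] using hz, rfl⟩

theorem rotateSurface_involutive : Function.Involutive (rotateSurface p) := by
  intro q
  obtain ⟨X, Y, h⟩ := exists_hasCoords q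
  have h' := h.rotate.rotate
  rw [neg_neg, neg_neg] at h'
  exact h'.unique h

theorem rotateSurface_mem_singularVertices :
    rotateSurface p q ∈ singularVertices p ↔ q ∈ singularVertices p := by
  obtain ⟨X, Y, h⟩ := exists_hasCoords q
  rw [h.mem_singularVertices_iff, h.rotate.mem_singularVertices_iff, abs_neg, abs_neg]

theorem OnGridLine.rotate (h : OnGridLine p q) : OnGridLine p (rotateSurface p q) := by
  obtain ⟨c, Y, h⟩ := h
  exact ⟨-c, -Y, by simpa only [Int.cast_neg] using h.rotate⟩

theorem Leaves.reverse (h : Leaves p a b γ (-t) X Y) :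
    Arrives p a b (fun s => rotateSurface p (γ (-s))) t (-X) (-Y) := by
  filter_upwards [tendsto_neg_nhdsLE.eventually h] with s hs
  convert hs.rotate using 1 <;> ring

theorem Arrives.reverse (h : Arrives p a b γ (-t) X Y) :
    Leaves p a b (fun s => rotateSurface p (γ (-s))) t (-X) (-Y) := by
  filter_upwards [tendsto_neg_nhdsGE.eventually h] with s hs
  convert hs.rotate using 1 <;> ring

theorem IsLinearOrbit.reverse (hγ : IsLinearOrbit p a b γ) :
    IsLinearOrbit p a b fun t => rotateSurface p (γ (-t)) := by
  intro t
  obtain ⟨⟨X, Y, hleave⟩, U, W, harrive⟩ := hγ (-t)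
  exact ⟨⟨-U, -W, harrive.reverse⟩, -X, -Y, hleave.reverse⟩

theorem IsPeriodicOrbit.of_reverse (h : IsPeriodicOrbit p fun t => rotateSurface p (γ (-t))) :
    IsPeriodicOrbit p γ := by
  obtain ⟨T, hT, h⟩ := h
  refine ⟨T, hT, fun t => rotateSurface_involutive.injective ?_⟩
  simpa using (h (-(t + T))).symm

theorem IsLinearOrbit.comp_add_const (hγ : IsLinearOrbit p a b γ) (T : ℝ) :
    IsLinearOrbit p a b fun t => γ (t + T) := by
  intro t
  obtain ⟨⟨X, Y, hleave⟩, U, W, harrive⟩ := hγ (t + T)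
  refine ⟨⟨X, Y, ?_⟩, U, W, ?_⟩
  · have hlim : Tendsto (· + T) (𝓝[≥] t) (𝓝[≥] (t + T)) :=
      (continuous_add_const T).continuousWithinAt.tendsto_nhdsWithin
        fun s hs => add_le_add_left hs T
    filter_upwards [hlim.eventually hleave] with s hs
    rwa [add_sub_add_right_eq_sub] at hs
  · have hlim : Tendsto (· + T) (𝓝[≤] t) (𝓝[≤] (t + T)) :=
      (continuous_add_const T).continuousWithinAt.tendsto_nhdsWithin
        fun s hs => add_le_add_left hs T
    filter_upwards [hlim.eventually harrive] with s hs
    rwa [add_sub_add_right_eq_sub] at hs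

theorem IsLinearOrbit.onGridLine_sub (hγ : IsLinearOrbit p a b γ) (ha : 0 < a)
    (h : OnGridLine p (γ t)) : OnGridLine p (γ (t - 1 / a)) := by
  have hrot : OnGridLine p (rotateSurface p (γ (- -t))) := by
    rw [neg_neg]
    exact h.rotate
  have h' := (hγ.reverse.onGridLine_add ha hrot).rotate
  rwa [rotateSurface_involutive, neg_add, neg_neg, ← sub_eq_add_neg] at h'

theorem IsLinearOrbit.eqOn_Icc_sub (hp : Antitone p) (hγ : IsLinearOrbit p a b γ)
    (hγ' : IsLinearOrbit p a b γ') (ha : 0 < a) (hb : 0 < b) (h : γ t = γ' t)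
    (hgrid : OnGridLine p (γ t)) (hq : γ t ∉ singularVertices p) :
    EqOn γ γ' (Icc (t - 1 / a) t) := by
  intro s hs
  have heq := hγ.reverse.eqOn_Icc (t := -t) hp hγ'.reverse ha hb
    (by simp only [neg_neg, h]) (by simpa only [neg_neg] using hgrid.rotate)
    (by simpa only [neg_neg, rotateSurface_mem_singularVertices] using hq)
    (x := -s) ⟨neg_le_neg hs.2, by linarith [hs.1]⟩
  simpa only [neg_neg] using rotateSurface_involutive.injective heq

end Reversal

section Periodicity

variable {p : ℕ → ℝ} {a b t T : ℝ} {γ : ℝ → StepSurface p}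

theorem IsLinearOrbit.eqOn_Ici (hp : Antitone p) (hγ : IsLinearOrbit p a b γ)
    {γ' : ℝ → StepSurface p} (hγ' : IsLinearOrbit p a b γ') (ha : 0 < a) (hb : 0 < b)
    (h : γ t = γ' t) (hgrid : OnGridLine p (γ t)) (hns : ∀ s ≥ t, γ s ∉ singularVertices p) :
    EqOn γ γ' (Ici t) := by
  have hgrids : ∀ n : ℕ, OnGridLine p (γ (t + n * (1 / a))) ∧
      γ (t + n * (1 / a)) = γ' (t + n * (1 / a)) := by
    intro n
    induction n with
    | zero => simpa using ⟨hgrid, h⟩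
    | succ n ih =>
      rw [Nat.cast_succ, add_one_mul, ← add_assoc]
      have hn : t ≤ t + n * (1 / a) := le_add_of_nonneg_right (by positivity)
      exact ⟨hγ.onGridLine_add ha ih.1, hγ.eqOn_Icc hp hγ' ha hb ih.2 ih.1 (hns _ hn)
        ⟨le_add_of_nonneg_right (by positivity), le_rfl⟩⟩
  intro s hs
  set n := ⌊(s - t) * a⌋₊
  have hfloor : n ≤ (s - t) * a := Nat.floor_le (mul_nonneg (sub_nonneg.2 hs) ha.le)
  have hlt : (s - t) * a < n + 1 := Nat.lt_floor_add_one _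
  have hle : n * (1 / a) ≤ s - t := by rwa [mul_one_div, div_le_iff₀ ha]
  have hle' : s - t ≤ (n + 1) * (1 / a) := by rw [mul_one_div, le_div_iff₀ ha]; exact hlt.le
  exact hγ.eqOn_Icc hp hγ' ha hb (hgrids n).2 (hgrids n).1
    (hns _ (le_add_of_nonneg_right (by positivity))) ⟨by linarith, by linarith⟩

theorem apply_add_nat_mul_eq (h : ∀ s ≥ t, γ (s + T) = γ s) (hT : 0 ≤ T) (k : ℕ) :
    γ (t + k * T) = γ t := by
  induction k with
  | zero => simp
  | succ k ih =>
    rw [Nat.cast_succ, add_one_mul, ← add_assoc, h _ (le_add_of_nonneg_right (by positivity)), ih]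

theorem IsLinearOrbit.isPeriodicOrbit_of_eq (hp : Antitone p) (hγ : IsLinearOrbit p a b γ)
    (ha : 0 < a) (hb : 0 < b) (hT : 0 < T) (h : γ (t + T) = γ t) (hgrid : OnGridLine p (γ t))
    (hns : ∀ s ≥ t, γ s ∉ singularVertices p) : IsPeriodicOrbit p γ := by
  have hγT := hγ.comp_add_const T
  have hback : ∀ n : ℕ, OnGridLine p (γ (t - n * (1 / a))) ∧
      ∀ s ≥ t - n * (1 / a), γ (s + T) = γ s := by
    intro n
    induction n with
    | zero =>
      simpa using ⟨hgrid, fun s hs => (hγ.eqOn_Ici hp hγT ha hb h.symm hgrid hns hs).symm⟩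
    | succ n ih =>
      obtain ⟨hgrid', hper⟩ := ih
      rw [Nat.cast_succ, add_one_mul, ← sub_sub]
      set τ := t - n * (1 / a)
      -- A singular vertex met before time `t` would be met again after time `t`.
      have hτ : γ τ ∉ singularVertices p := by
        obtain ⟨k, hk⟩ := exists_nat_ge ((t - τ) / T)
        rw [← apply_add_nat_mul_eq hper hT.le k]
        exact hns _ (by linarith [(div_le_iff₀ hT).1 hk])
      refine ⟨hγ.onGridLine_sub ha hgrid', fun s hs => ?_⟩
      rcases le_total τ s with hτs | hsτ
      · exact hper s hτs
      · exact (hγ.eqOn_Icc_sub hp hγT ha hb (hper τ le_rfl).symm hgrid' hτ ⟨hs, hsτ⟩).symm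
  refine ⟨T, hT, fun s => ?_⟩
  obtain ⟨n, hn⟩ := exists_nat_ge ((t - s) * a)
  refine (hback n).2 s ?_
  rw [ge_iff_le, sub_le_comm, mul_one_div, le_div_iff₀ ha]
  exact hn

end Periodicity

section Recurrence

variable {p : ℕ → ℝ} {K : Set (StepSurface p)}

/-- The distance of a point of the surface from the axis `X = 0`. -/
def absX (p : ℕ → ℝ) : StepSurface p → ℝ :=
  Quotient.lift (fun z : unfoldedTable p => |z.1.1|) fun _ _ h => h.1

theorem continuous_absX : Continuous (absX p) :=
  Continuous.quotient_lift (by fun_prop) _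

theorem HasCoords.absX_eq {q : StepSurface p} {X Y : ℝ} (h : HasCoords p q X Y) :
    absX p q = |X| := by
  obtain ⟨hz, rfl⟩ := h
  rfl

theorem exists_abs_le_of_isCompact (hK : IsCompact K) :
    ∃ N : ℕ, ∀ q ∈ K, ∀ X Y, HasCoords p q X Y → |X| ≤ N := by
  obtain ⟨M, hM⟩ := (hK.image continuous_absX).bddAbove
  obtain ⟨N, hN⟩ := exists_nat_ge M
  refine ⟨N, fun q hq X Y h => ?_⟩
  rw [← h.absX_eq]
  exact (hM (mem_image_of_mem _ hq)).trans hN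

theorem HasCoords.eventually_le_abs_sub {q₀ : StepSurface p} {X Y₀ : ℝ}
    (h₀ : HasCoords p q₀ X Y₀) (hK : IsClosed K) (hq₀ : q₀ ∉ K) :
    ∀ᶠ δ in 𝓝[>] (0 : ℝ), ∀ q ∈ K, ∀ Y, HasCoords p q X Y → δ ≤ |Y - Y₀| := by
  obtain ⟨hz, rfl⟩ := h₀
  obtain ⟨ε, hε, hball⟩ := Metric.isOpen_iff.1
    (hK.preimage (continuous_quotient_mk' (s := sideSetoid p))).isOpen_compl ⟨(X, Y₀), hz⟩ hq₀
  filter_upwards [Ioc_mem_nhdsGT hε]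
  rintro δ hδ - hq Y ⟨hXY, rfl⟩
  by_contra! hlt
  refine hball (a := ⟨(X, Y), hXY⟩) ?_ hq
  rw [Metric.mem_ball, Subtype.dist_eq, Prod.dist_eq, dist_self, Real.dist_eq]
  exact max_lt hε (hlt.trans_le hδ.2)

theorem eventually_avoidsVertex_of_isClosed (hp : Antitone p) (hK : IsClosed K)
    (hKV : Disjoint K (singularVertices p)) (c : ℤ) :
    ∀ᶠ δ in 𝓝[>] (0 : ℝ), ∀ q ∈ K, ∀ Y, HasCoords p q (c + 1) Y → AvoidsVertex p δ c Y := by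
  by_cases hv : HasVertex p c
  · have hfar (Y₀ : ℝ) (hY₀ : |Y₀| = foot p c) :
        ∀ᶠ δ in 𝓝[>] (0 : ℝ), ∀ q ∈ K, ∀ Y, HasCoords p q (c + 1) Y → δ ≤ |Y - Y₀| := by
      have h₀ : HasCoords p _ (c + 1) Y₀ := ⟨mem_unfoldedTable_of_mem_Icc
        ⟨(lt_add_one (c : ℝ)).le, le_rfl⟩ (hY₀.trans_le (min_le_left _ _)), rfl⟩
      exact h₀.eventually_le_abs_sub hK
        (disjoint_right.1 hKV ((h₀.mem_singularVertices_iff_hasVertex hp).2 ⟨hv, hY₀⟩))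
    have hfoot : |foot p c| = foot p c := abs_of_pos (lt_min hv.1 hv.2.1)
    filter_upwards [hfar _ hfoot, hfar (-foot p c) (by rwa [abs_neg])] with δ hδ hδ' q hq Y h _
    rcases abs_choice Y with hY | hY
    · rw [hY]
      exact hδ q hq Y h
    · rw [hY, ← neg_add', abs_neg, ← sub_neg_eq_add]
      exact hδ' q hq Y h
  · exact Eventually.of_forall fun δ q _ Y _ hv' => absurd hv' hv

theorem exists_lt_abs_sub_lt {c : ℕ → ℤ} {y : ℕ → ℝ} {N : ℤ} {M δ : ℝ} (hδ : 0 < δ)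
    (hc : ∀ i, |c i| ≤ N) (hy : ∀ i, |y i| ≤ M) :
    ∃ i j, i < j ∧ c j = c i ∧ |y j - y i| < δ := by
  obtain ⟨i, -, j, -, hij, h⟩ := Set.infinite_univ.exists_ne_map_eq_of_mapsTo
    (f := fun i => (c i, ⌊y i / δ⌋)) (t := Icc (-N) N ×ˢ Icc ⌊-M / δ⌋ ⌊M / δ⌋)
    (fun i _ => ⟨abs_le.1 (hc i), Int.floor_le_floor (by gcongr; exact (abs_le.1 (hy i)).1),
      Int.floor_le_floor (by gcongr; exact (abs_le.1 (hy i)).2)⟩)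
    ((Set.finite_Icc _ _).prod (Set.finite_Icc _ _))
  obtain ⟨hcij, hfloor⟩ := Prod.mk.inj h
  have hclose := Int.abs_sub_lt_one_of_floor_eq_floor hfloor
  rw [← sub_div, abs_div, abs_of_pos hδ, div_lt_one hδ] at hclose
  rcases lt_or_gt_of_ne hij with hlt | hlt
  · exact ⟨i, j, hlt, hcij.symm, by rwa [abs_sub_comm]⟩
  · exact ⟨j, i, hlt, hcij, hclose⟩

theorem IsLinearOrbit.isPeriodicOrbit_of_isCompact (hp : Antitone p)
    (hV : (singularVertices p).Nonempty) {a b : ℝ} {γ : ℝ → StepSurface p}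
    (hγ : IsLinearOrbit p a b γ) (ha : 0 < a) (hb : 0 < b) (hcompact : IsCompact K)
    (hclosed : IsClosed K) (hKV : Disjoint K (singularVertices p)) (hγK : ∀ t ≥ 0, γ t ∈ K) :
    IsPeriodicOrbit p γ := by
  have hns (t : ℝ) (ht : 0 ≤ t) : γ t ∉ singularVertices p := disjoint_left.1 hKV (hγK t ht)
  obtain ⟨t₀, ht₀, C, v, hC, hcoords⟩ := hγ.exists_isItinerary hp ha hb hns
  have hmem (n : ℕ) : γ (t₀ + n * (1 / a)) ∈ K := hγK _ (by positivity)
  obtain ⟨N, hN⟩ := exists_abs_le_of_isCompact hcompact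
  have hCN (n : ℕ) : |C n| ≤ N + 1 := by
    have h := hN _ (hmem n) _ _ (hcoords n)
    have h' : |C n + 1| ≤ N := by exact_mod_cast h
    grind
  obtain ⟨δ, hδ, hδ0⟩ := (((finite_Icc (-(N + 1) : ℤ) (N + 1)).eventually_all.2 fun c _ =>
    eventually_avoidsVertex_of_isClosed hp hclosed hKV c).and self_mem_nhdsWithin).exists
  have hv (n : ℕ) : AvoidsVertex p δ (C n) (v n) :=
    hδ _ (abs_le.1 (hCN n)) _ (hmem n) _ (hcoords n)
  obtain ⟨i, j, hij, hCij, hvij⟩ := exists_lt_abs_sub_lt hδ0 hCN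
    fun n => (hC n).abs_le.trans (colHeight_le_zero hp _)
  obtain ⟨c, hc, hlt⟩ := exists_colHeight_lt hV
  have hvj : v j - v i = 0 := eq_zero_of_return hp (hC.comp_add i)
    (fun n => (abs_le.1 (hCN (n + i))).2) hc hlt hvij (fun n => hv (n + i)) (T := j - i)
    (by simpa only [Nat.sub_add_cancel hij.le, zero_add] using hCij)
    (by simp only [Nat.sub_add_cancel hij.le, zero_add, add_sub_cancel])
  have hreturn : γ (t₀ + i * (1 / a) + (j - i) * (1 / a)) = γ (t₀ + i * (1 / a)) := by
    rw [add_assoc, ← add_mul, add_sub_cancel]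
    have h := hcoords j
    rw [hCij, sub_eq_zero.1 hvj] at h
    exact h.unique (hcoords i)
  have hgrid : OnGridLine p (γ (t₀ + i * (1 / a))) :=
    ⟨C i + 1, v i, by simpa only [Int.cast_add, Int.cast_one] using hcoords i⟩
  have hti : 0 ≤ t₀ + i * (1 / a) := by positivity
  exact hγ.isPeriodicOrbit_of_eq hp ha hb
    (mul_pos (sub_pos.2 (Nat.cast_lt.2 hij)) (one_div_pos.2 ha)) hreturn hgrid
    fun s hs => hns s (hti.trans hs)

theorem IsLinearOrbit.isPeriodicOrbit_of_isCompact_of_nonpos (hp : Antitone p)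
    (hV : (singularVertices p).Nonempty) {a b : ℝ} {γ : ℝ → StepSurface p}
    (hγ : IsLinearOrbit p a b γ) (ha : 0 < a) (hb : 0 < b) (hcompact : IsCompact K)
    (hclosed : IsClosed K) (hKV : Disjoint K (singularVertices p)) (hγK : ∀ t ≤ 0, γ t ∈ K) :
    IsPeriodicOrbit p γ := by
  have himage : rotateSurface p '' K = rotateSurface p ⁻¹' K :=
    congrFun (image_eq_preimage_of_inverse rotateSurface_involutive.leftInverse
      rotateSurface_involutive.leftInverse) K
  refine (hγ.reverse.isPeriodicOrbit_of_isCompact hp hV ha hb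
    (hcompact.image continuous_rotateSurface)
    (himage ▸ hclosed.preimage continuous_rotateSurface) ?_
    fun t ht => mem_image_of_mem _ (hγK _ (neg_nonpos.2 ht))).of_reverse
  rw [himage, disjoint_left]
  exact fun q hq hqV => disjoint_left.1 hKV hq (rotateSurface_mem_singularVertices.2 hqV)

end Recurrence

theorem exists_isCompact_of_closureWithInfinity {p : ℕ → ℝ} {A : Set (StepSurface p)}
    (h : ¬(closureWithInfinity p A ∩ singularVerticesWithInfinity p).Nonempty) :
    ∃ K, IsCompact K ∧ IsClosed K ∧ Disjoint K (singularVertices p) ∧ A ⊆ K := by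
  have hclosed : IsClosed (closureWithInfinity p A) := isClosed_closure
  have hinf : (∞ : OnePoint (StepSurface p)) ∉ closureWithInfinity p A := fun hm =>
    h ⟨∞, hm, Or.inr rfl⟩
  have hcompact := (OnePoint.isOpen_def.1 hclosed.isOpen_compl).1 hinf
  rw [preimage_compl, compl_compl] at hcompact
  refine ⟨_, hcompact, hclosed.preimage OnePoint.continuous_coe, ?_, ?_⟩
  · exact disjoint_left.2 fun v hm hv => h ⟨v, hm, Or.inl (mem_image_of_mem _ hv)⟩
  · exact fun q hq => subset_closure (mem_image_of_mem _ hq)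

theorem mainTheorem7_general {p : ℕ → ℝ} (hp : Antitone p) (hV : (singularVertices p).Nonempty)
    {a b : ℝ} (ha : 0 < a) (hb : 0 < b) {γ : ℝ → StepSurface p} (hγ : IsLinearOrbit p a b γ)
    (hnp : ¬IsPeriodicOrbit p γ) :
    (closureWithInfinity p (γ '' Ici 0) ∩ singularVerticesWithInfinity p).Nonempty ∧
    (closureWithInfinity p (γ '' Iic 0) ∩ singularVerticesWithInfinity p).Nonempty := by
  constructor <;> by_contra hempty <;>
    obtain ⟨K, hcompact, hclosed, hKV, hγK⟩ := exists_isCompact_of_closureWithInfinity hempty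
  · exact hnp (hγ.isPeriodicOrbit_of_isCompact hp hV ha hb hcompact hclosed hKV
      fun t ht => hγK (mem_image_of_mem γ ht))
  · exact hnp (hγ.isPeriodicOrbit_of_isCompact_of_nonpos hp hV ha hb hcompact hclosed hKV
      fun t ht => hγK (mem_image_of_mem γ ht))

theorem mainTheorem7 (p : ℕ → ℝ) (hnonneg : ∀ n, 0 ≤ p n) (hanti : Antitone p)
    (hlim : Tendsto p atTop (𝓝 0)) (hV : (singularVertices p).Nonempty)
    (θ : ℝ) (hθ : θ ∈ Ioo 0 (Real.pi / 2))
    (x : StepSurface p) (γ : ℝ → StepSurface p) (hγ : IsBilliardOrbit p θ γ) (hx : γ 0 = x)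
    (hnp : ¬ IsPeriodicOrbit p γ) :
    (closureWithInfinity p (γ '' Ici 0) ∩ singularVerticesWithInfinity p).Nonempty ∧
    (closureWithInfinity p (γ '' Iic 0) ∩ singularVerticesWithInfinity p).Nonempty :=
  mainTheorem7_general hanti hV (Real.cos_pos_of_mem_Ioo ⟨by linarith [hθ.1, hθ.2], hθ.2⟩)
    (Real.sin_pos_of_mem_Ioo ⟨hθ.1, by linarith [hθ.1, hθ.2]⟩) hγ.isLinearOrbit hnp
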